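/- For an integer $n\ge 1$ let $Q_n=\{u^2 : u\in(\mathbb Z/n\mathbb Z)^\times\}$, and let $G_n=\mathrm{Cay}(\mathbb Z/n\mathbb Z,\pm Q_n)$ be the quadratic unitary Cayley graph: its vertices are the elements of $\mathbb Z/n\mathbb Z$, and distinct vertices $a,b$ are adjacent if and only if $a-b\in\{\pm u^2 : u\in(\mathbb Z/n\mathbb Z)^\times\}$. Let $\delta_3(n)=1$ if $n$ has a prime factor $p>3$ with $p\equiv 3\pmod 4$, and $\delta_3(n)=0$ otherwise. Let $\mathrm{diam}$ denote the diameter of a graph (with value $\infty$ if the graph is disconnected). **Theorem.** Let $n>0$ be even. Then $$\mathrm{diam}(G_n)=\begin{cases} 12, & \text{if } n \text{ is a multiple of } 24;\\ 6, & \text{if } n \text{ is an odd multiple of } 12;\\ 5, & \text{if } n \text{ is a multiple of } 10 \text{ but not of } 12;\\ 4, & \text{if } n=8K \text{ for some } K>0 \text{ coprime to } 15;\\ 3+\delta_3(n), & \text{if } n=6K \text{ for some } K>0 \text{ coprime to } 10;\\ 3+\delta_3(n), & \text{if } n=4K \text{ for some } K>1 \text{ coprime to } 30;\\ 3, & \text{if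 } n=2K \text{ for some } K>1 \text{ coprime to } 30;\\ 2, & \text{if } n=4;\\ 1, & \text{if } n=2. \end{cases}$$ Moreover, $\mathrm{diam}(G_n)\le 12$ for every integer $n\ge 1$ (even or odd), and $\mathrm{diam}(G_{p^m})\le 4$ for every prime $p$ and every integer $m\ge 0$. -/

import Mathlib

/-- The set `Q_n` of quadratic units modulo `n`: the squares of the units of `ℤ/nℤ`. -/
def quadraticUnits (n : ℕ) : Set (ZMod n) :=
  {q | ∃ u : (ZMod n)ˣ, q = (u : ZMod n) ^ 2}

/-- The set `T_n = ±Q_n`. -/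
def signedQuadraticUnits (n : ℕ) : Set (ZMod n) :=
  {t | t ∈ quadraticUnits n ∨ -t ∈ quadraticUnits n}

/-- The quadratic unitary Cayley graph `G_n = Cay(ℤ/nℤ, ±Q_n)`, as a simple graph: distinct
residues are adjacent iff their difference lies in `±Q_n`.  (Only for `n = 1` does `±Q_n` contain
`0`; there the loop at the single vertex is dropped.) -/
def quadraticUnitaryCayleyGraph (n : ℕ) : SimpleGraph (ZMod n) :=
  SimpleGraph.addCayley (signedQuadraticUnits n)

/-- `δ₃(n)` is `1` if `n` has a prime factor `p > 3` with `p ≡ 3 (mod 4)`, and `0` otherwise. -/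
def deltaThree (n : ℕ) : ℕ :=
  if ∃ p ∈ n.primeFactors, 3 < p ∧ p % 4 = 3 then 1 else 0

/-- The characterisation of adjacency in `G_n` by differences. -/
theorem quadraticUnitaryCayleyGraph_adj (n : ℕ) (a b : ZMod n) :
    (quadraticUnitaryCayleyGraph n).Adj a b ↔ a ≠ b ∧ a - b ∈ signedQuadraticUnits n := by
  simp only [quadraticUnitaryCayleyGraph, SimpleGraph.addCayley_adj, signedQuadraticUnits,
    Set.mem_ofPred_eq]
  have h1 : -a + b = -(a - b) := by ring
  have h2 : -b + a = a - b := by ring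
  rw [h1, h2, neg_neg]
  tauto

/-! The distance between two residues is the least `k` for which their difference is a sum of `k`
terms `±u²`, `u` a unit. For a fixed sign vector `ε` with `k > 0`, solvability is local: the Chinese
remainder theorem and Hensel lifting reduce it to conditions at the primes dividing `n`
(`isSignedSquareSum_of_local`).

At 2 and 3 unit squares are 1 modulo `gcd(n, 24)`, so the condition is `x ≡ ∑ ε i` modulo that gcd.
At 5 unit squares are ±1: four terms give everything, but an odd number of terms below four misses
0. At `p ≥ 7` three terms give everything, and two miss at most 0, which they miss only if the signs
agree and `p ≡ 3 (mod 4)`.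

The sums of `k` signs are the numbers `2s - k`, `0 ≤ s ≤ k`. They meet every class modulo `2d` of
the parity of `k` once `d ≤ k + 1`, which yields the upper bounds. The lower bounds come from parity
and from the targets `k`, `5`, `p` and `2p`, each hard at one of these places. -/

/-- The integer `x` is congruent modulo `n` to a sum of `k` squares of units with signs `ε`. -/
def IsSignedSquareSum (n : ℕ) {k : ℕ} (ε : Fin k → ℤˣ) (x : ℤ) : Prop :=
  ∃ u : Fin k → ℤ, (∀ i, IsCoprime (u i) (n : ℤ)) ∧ (n : ℤ) ∣ x - ∑ i, (ε i : ℤ) * u i ^ 2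

theorem IsSignedSquareSum.of_dvd {m n k : ℕ} {ε : Fin k → ℤˣ} {x : ℤ} (hmn : m ∣ n)
    (h : IsSignedSquareSum n ε x) : IsSignedSquareSum m ε x := by
  obtain ⟨u, hu, hx⟩ := h
  have hmn' : (m : ℤ) ∣ n := by exact_mod_cast hmn
  exact ⟨u, fun i => (hu i).of_isCoprime_of_dvd_right hmn', hmn'.trans hx⟩

theorem isSignedSquareSum_of_dvd_sub_sum {n k : ℕ} {ε : Fin k → ℤˣ} {x : ℤ}
    (h : (n : ℤ) ∣ x - ∑ i, (ε i : ℤ)) : IsSignedSquareSum n ε x :=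
  ⟨fun _ => 1, fun _ => isCoprime_one_left, by simpa using h⟩

theorem isSignedSquareSum_cons {n k : ℕ} (e : ℤˣ) (ε : Fin k → ℤˣ) (x : ℤ) :
    IsSignedSquareSum n (Fin.cons e ε : Fin (k + 1) → ℤˣ) x ↔
      ∃ w : ℤ, IsCoprime w (n : ℤ) ∧ IsSignedSquareSum n ε (x - (e : ℤ) * w ^ 2) := by
  constructor
  · rintro ⟨u, hu, hx⟩
    refine ⟨u 0, hu 0, fun i => u i.succ, fun i => hu _, ?_⟩
    simpa [Fin.sum_univ_succ, sub_sub] using hx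
  · rintro ⟨w, hw, u, hu, hx⟩
    refine ⟨Fin.cons w u, Fin.cases hw hu, ?_⟩
    simpa [Fin.sum_univ_succ, sub_sub] using hx

theorem Int.isCoprime_of_dvd_sub {a b n : ℤ} (h : n ∣ a - b) (hb : IsCoprime b n) :
    IsCoprime a n := by
  obtain ⟨c, hc⟩ := h
  obtain rfl : a = b + n * c := by linarith
  exact hb.add_mul_left_left c

theorem IsSignedSquareSum.congr {n k : ℕ} {ε : Fin k → ℤˣ} {x y : ℤ} (hxy : (n : ℤ) ∣ x - y)
    (h : IsSignedSquareSum n ε y) : IsSignedSquareSum n ε x := by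
  obtain ⟨u, hu, hy⟩ := h
  exact ⟨u, hu, by simpa using dvd_add hxy hy⟩

theorem IsSignedSquareSum.mul {m n k : ℕ} {ε : Fin k → ℤˣ} {x : ℤ} (hmn : m.Coprime n)
    (hm : IsSignedSquareSum m ε x) (hn : IsSignedSquareSum n ε x) :
    IsSignedSquareSum (m * n) ε x := by
  obtain ⟨u, hu, hux⟩ := hm
  obtain ⟨v, hv, hvx⟩ := hn
  have hmn' : IsCoprime (m : ℤ) n := Nat.isCoprime_iff_coprime.mpr hmn
  obtain ⟨a, b, hab⟩ := hmn'
  set w : Fin k → ℤ := fun i => u i * (b * n) + v i * (a * m) with hw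
  have hwu : ∀ i, (m : ℤ) ∣ w i - u i := fun i =>
    ⟨a * (v i - u i), by simp only [hw]; linear_combination (u i) * hab⟩
  have hwv : ∀ i, (n : ℤ) ∣ w i - v i := fun i =>
    ⟨b * (u i - v i), by simp only [hw]; linear_combination (v i) * hab⟩
  have key : ∀ (d : ℤ) (z : Fin k → ℤ), (∀ i, d ∣ w i - z i) →
      d ∣ x - ∑ i, (ε i : ℤ) * z i ^ 2 → d ∣ x - ∑ i, (ε i : ℤ) * w i ^ 2 := by
    intro d z hz hd
    have h1 : d ∣ ∑ i, (ε i : ℤ) * z i ^ 2 - ∑ i, (ε i : ℤ) * w i ^ 2 := by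
      rw [← Finset.sum_sub_distrib]
      refine Finset.dvd_sum fun i _ => ?_
      obtain ⟨c, hc⟩ := hz i
      exact ⟨-(ε i : ℤ) * c * (z i + w i), by linear_combination -(ε i : ℤ) * (z i + w i) * hc⟩
    simpa using dvd_add hd h1
  refine ⟨w, fun i => ?_, ?_⟩
  · push_cast
    exact (Int.isCoprime_of_dvd_sub (hwu i) (hu i)).mul_right
      (Int.isCoprime_of_dvd_sub (hwv i) (hv i))
  · push_cast
    exact (show IsCoprime (m : ℤ) n from ⟨a, b, hab⟩).mul_dvd (key _ u hwu hux) (key _ v hwv hvx)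

/-! ### Hensel lifting and the local-global principle -/

theorem Int.exists_sq_dvd_sub_odd_prime_pow {p : ℕ} (hp : p.Prime) (hp2 : p ≠ 2) {y u : ℤ}
    (hu : IsCoprime u (p : ℤ)) (hy : (p : ℤ) ∣ y - u ^ 2) (m : ℕ) :
    ∃ w : ℤ, IsCoprime w (p : ℤ) ∧ (p : ℤ) ^ (m + 1) ∣ y - w ^ 2 := by
  induction m with
  | zero => exact ⟨u, hu, by simpa using hy⟩
  | succ m ih =>
    obtain ⟨w, hw, c, hc⟩ := ih
    have h2 : IsCoprime (2 : ℤ) p := by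
      have := (Nat.coprime_primes Nat.prime_two hp).mpr (Ne.symm hp2)
      exact_mod_cast Nat.isCoprime_iff_coprime.mpr this
    obtain ⟨a, b, hab⟩ := h2.mul_left hw
    -- Newton step: `a` inverts `2 * w` modulo `p`.
    refine ⟨w + (p : ℤ) ^ (m + 1) * (a * c), ?_, c * b - p ^ m * (a * c) ^ 2, ?_⟩
    · exact Int.isCoprime_of_dvd_sub ⟨p ^ m * (a * c), by ring⟩ hw
    · linear_combination hc - (p : ℤ) ^ (m + 1) * c * hab

theorem Int.exists_sq_dvd_sub_two_pow {y u : ℤ} (hu : IsCoprime u 2) (hy : 8 ∣ y - u ^ 2)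
    (m : ℕ) : ∃ w : ℤ, IsCoprime w 2 ∧ (2 : ℤ) ^ (m + 3) ∣ y - w ^ 2 := by
  induction m with
  | zero => exact ⟨u, hu, by simpa using hy⟩
  | succ m ih =>
    obtain ⟨w, hw, c, hc⟩ := ih
    have hodd : Odd w := Int.isCoprime_two_right.mp hw
    obtain ⟨d, hd⟩ := hodd
    -- Adding half the modulus times `c` changes `w ^ 2` by `2 ^ (m + 3) * c * w` to the needed
    -- order, and `w` is odd, so no inverse is needed.
    refine ⟨w + 2 ^ (m + 2) * c, ?_, -c * d - 2 ^ m * c ^ 2, ?_⟩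
    · exact Int.isCoprime_of_dvd_sub ⟨2 ^ (m + 1) * c, by ring⟩ hw
    · linear_combination hc - (2 : ℤ) ^ (m + 3) * c * hd

/-- It suffices to lift one square: the other terms keep their units and move to the left-hand side.
This is where `0 < k` enters. -/
theorem IsSignedSquareSum.lift {q r k : ℕ} {ε : Fin k → ℤˣ} {x : ℤ} (hk : 0 < k)
    (hcop : ∀ u : ℤ, IsCoprime u (r : ℤ) → IsCoprime u (q : ℤ))
    (hlift : ∀ y u : ℤ, IsCoprime u (r : ℤ) → (r : ℤ) ∣ y - u ^ 2 →
      ∃ w : ℤ, IsCoprime w (r : ℤ) ∧ (q : ℤ) ∣ y - w ^ 2)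
    (h : IsSignedSquareSum r ε x) : IsSignedSquareSum q ε x := by
  obtain ⟨k, rfl⟩ := Nat.exists_eq_add_of_lt hk
  obtain ⟨u, hu, hx⟩ := h
  rw [Fin.sum_univ_succ] at hx
  have hsq : (ε 0 : ℤ) * (ε 0 : ℤ) = 1 := by
    rcases Int.units_eq_one_or (ε 0) with h | h <;> simp [h]
  obtain ⟨w, hw, hwx⟩ := hlift ((ε 0 : ℤ) * (x - ∑ i : Fin _, (ε i.succ : ℤ) * u i.succ ^ 2))
    (u 0) (hu 0) (by
      obtain ⟨c, hc⟩ := hx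
      exact ⟨ε 0 * c, by linear_combination (ε 0 : ℤ) * hc + (u 0) ^ 2 * hsq⟩)
  refine ⟨Fin.cons w fun i => u i.succ, Fin.cases (hcop _ hw) fun i => hcop _ (hu _), ?_⟩
  rw [Fin.sum_univ_succ]
  obtain ⟨c, hc⟩ := hwx
  refine ⟨ε 0 * c, ?_⟩
  simp only [Fin.cons_zero, Fin.cons_succ]
  linear_combination (ε 0 : ℤ) * hc - (x - ∑ i : Fin _, (ε i.succ : ℤ) * u i.succ ^ 2) * hsq

theorem IsSignedSquareSum.odd_prime_pow {p k : ℕ} {ε : Fin k → ℤˣ} {x : ℤ} (hp : p.Prime)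
    (hp2 : p ≠ 2) (hk : 0 < k) (m : ℕ) (h : IsSignedSquareSum p ε x) :
    IsSignedSquareSum (p ^ (m + 1)) ε x :=
  h.lift hk (fun u hu => by push_cast; exact hu.pow_right) fun y u hu hy => by
    push_cast; exact Int.exists_sq_dvd_sub_odd_prime_pow hp hp2 hu hy m

theorem isSignedSquareSum_two_pow {k : ℕ} {ε : Fin k → ℤˣ} {x : ℤ} (hk : 0 < k) (m : ℕ)
    (h : (Nat.gcd (2 ^ m) 24 : ℤ) ∣ x - ∑ i, (ε i : ℤ)) : IsSignedSquareSum (2 ^ m) ε x := by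
  rcases lt_or_ge m 3 with hm | hm
  · refine isSignedSquareSum_of_dvd_sub_sum ?_
    have h2 : (2 ^ m).gcd 24 = 2 ^ m := by interval_cases m <;> rfl
    rwa [h2] at h
  · obtain ⟨m, rfl⟩ := Nat.exists_eq_add_of_le' hm
    have hc (j : ℕ) (u : ℤ) : IsCoprime u (8 : ℕ) → IsCoprime u ((2 : ℤ) ^ j) := fun hu =>
      (hu.of_isCoprime_of_dvd_right (by norm_num)).pow_right
    have h8 : Nat.gcd (2 ^ (m + 3)) 24 = 8 := by
      have h1 : (2 ^ (m + 3)).gcd 24 ∣ 24 := Nat.gcd_dvd_right _ _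
      have h2 : 8 ∣ (2 ^ (m + 3)).gcd 24 := Nat.dvd_gcd ⟨2 ^ m, by ring⟩ (by norm_num)
      have h3 : ¬ 3 ∣ (2 ^ (m + 3)).gcd 24 := fun h => by
        have := Nat.prime_three.dvd_of_dvd_pow (h.trans (Nat.gcd_dvd_left _ _))
        omega
      have h4 : (2 ^ (m + 3)).gcd 24 ≤ 24 := Nat.le_of_dvd (by norm_num) h1
      generalize (2 ^ (m + 3)).gcd 24 = g at *
      interval_cases g <;> omega
    rw [h8] at h
    refine (isSignedSquareSum_of_dvd_sub_sum h).lift hk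
      (fun u hu => by push_cast; exact hc _ u hu) fun y u hu hy => ?_
    obtain ⟨w, hw, hwy⟩ := Int.exists_sq_dvd_sub_two_pow (by simpa using hc 1 u hu) hy m
    exact ⟨w, by simpa using (hw.pow_right : IsCoprime w (2 ^ 3)), by exact_mod_cast hwy⟩

/-- The local-global principle for sums of signed squares of units. -/
theorem isSignedSquareSum_of_local {n k : ℕ} {ε : Fin k → ℤˣ} {x : ℤ} (hn : 0 < n) (hk : 0 < k)
    (h24 : (Nat.gcd n 24 : ℤ) ∣ x - ∑ i, (ε i : ℤ))
    (hloc : ∀ p : ℕ, p.Prime → 5 ≤ p → p ∣ n → IsSignedSquareSum p ε x) :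
    IsSignedSquareSum n ε x := by
  induction n using Nat.recOnPosPrimePosCoprime with
  | zero => omega
  | one => exact ⟨fun _ => 1, fun _ => isCoprime_one_left, by simp⟩
  | prime_pow p m hp hm =>
    rcases eq_or_ne p 2 with rfl | hp2
    · exact isSignedSquareSum_two_pow hk m (by exact_mod_cast h24)
    · obtain ⟨m, rfl⟩ := Nat.exists_eq_add_of_lt hm
      rw [zero_add] at *
      refine IsSignedSquareSum.odd_prime_pow hp hp2 hk m ?_
      have hpd : p ∣ p ^ (m + 1) := dvd_pow_self p (by omega)
      rcases eq_or_ne p 3 with rfl | hp3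
      · refine isSignedSquareSum_of_dvd_sub_sum (dvd_trans ?_ h24)
        exact_mod_cast Nat.dvd_gcd hpd (by norm_num)
      · refine hloc p hp ?_ hpd
        have := hp.two_le
        have : p ≠ 4 := by rintro rfl; revert hp; decide
        omega
  | coprime a b ha hb hab iha ihb =>
    have hd : ∀ c, c ∣ a * b → (Nat.gcd c 24 : ℤ) ∣ x - ∑ i, (ε i : ℤ) := fun c hc =>
      dvd_trans (by exact_mod_cast Nat.gcd_dvd_gcd_of_dvd_left 24 hc) h24
    exact (iha (by omega) (hd _ (dvd_mul_right _ _))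
        fun p hp h5 hpa => hloc p hp h5 (hpa.mul_right _)).mul hab
      (ihb (by omega) (hd _ (dvd_mul_left _ _)) fun p hp h5 hpb => hloc p hp h5 (hpb.mul_left _))

/-! ### Signed squares in prime fields with `p ≥ 7` -/

theorem isSignedSquareSum_iff_zmod {p k : ℕ} [Fact p.Prime] {ε : Fin k → ℤˣ} {x : ℤ} :
    IsSignedSquareSum p ε x ↔ ∃ u : Fin k → ZMod p, (∀ i, u i ≠ 0) ∧
      (x : ZMod p) = ∑ i, ((ε i : ℤ) : ZMod p) * u i ^ 2 := by
  have hcop (w : ℤ) : IsCoprime w (p : ℤ) ↔ (w : ZMod p) ≠ 0 := by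
    rw [isCoprime_comm, ← ZMod.coe_int_isUnit_iff_isCoprime, isUnit_iff_ne_zero]
  constructor
  · rintro ⟨u, hu, hx⟩
    refine ⟨fun i => u i, fun i => (hcop _).mp (hu i), ?_⟩
    rw [← ZMod.intCast_zmod_eq_zero_iff_dvd] at hx
    push_cast at hx
    exact sub_eq_zero.mp hx
  · rintro ⟨u, hu, hx⟩
    refine ⟨fun i => (u i).cast, fun i => (hcop _).mpr (by simpa using hu i), ?_⟩
    rw [← ZMod.intCast_zmod_eq_zero_iff_dvd]
    push_cast
    simp [hx]

theorem ZMod.natCast_ne_zero_of_lt {p a : ℕ} (ha : 0 < a) (hap : a < p) : (a : ZMod p) ≠ 0 := by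
  rw [Ne, ZMod.natCast_eq_zero_iff]
  exact Nat.not_dvd_of_pos_of_lt ha hap

theorem ZMod.prime_ge_seven_units {p : ℕ} [hp : Fact p.Prime] (h7 : 7 ≤ p) :
    (2 : ZMod p) ≠ 0 ∧ (3 : ZMod p) ≠ 0 ∧ (4 : ZMod p) ≠ 0 ∧ (5 : ZMod p) ≠ 0 := by
  have h (a : ℕ) := ZMod.natCast_ne_zero_of_lt (a := a) (p := p)
  exact ⟨by simpa using h 2 (by omega) (by omega), by simpa using h 3 (by omega) (by omega),
    by simpa using h 4 (by omega) (by omega), by simpa using h 5 (by omega) (by omega)⟩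

open Polynomial in
theorem ZMod.exists_ne_zero_eval_ne_zero {p : ℕ} [Fact p.Prime] {f : (ZMod p)[X]} (hf : f ≠ 0)
    (hd : f.natDegree < p) : ∃ r : ZMod p, f.eval r ≠ 0 := by
  by_contra! h
  exact hf (Polynomial.eq_zero_of_natDegree_lt_card_of_eval_eq_zero f Function.injective_id
    (by simpa using h) (by simpa [ZMod.card] using hd))

open Polynomial in
/-- In `𝔽_p` with `p ≥ 7`, every element is a difference of two nonzero squares. -/
theorem ZMod.exists_sq_sub_sq {p : ℕ} [Fact p.Prime] (h7 : 7 ≤ p) (y : ZMod p) :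
    ∃ u v : ZMod p, u ≠ 0 ∧ v ≠ 0 ∧ y = u ^ 2 - v ^ 2 := by
  obtain ⟨h2, -⟩ := ZMod.prime_ge_seven_units h7
  -- Write `y` as the product of `r` and `y / r`. Both squares are nonzero when `r ^ 2 ≠ ±y`, and
  -- the excluded `r` are the roots of this quintic, fewer than `p`.
  have hdeg : (X * (X ^ 4 - C (y ^ 2)) : (ZMod p)[X]).natDegree = 5 := by compute_degree!
  obtain ⟨r, hr⟩ := ZMod.exists_ne_zero_eval_ne_zero
    (f := (X * (X ^ 4 - C (y ^ 2)) : (ZMod p)[X]))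
    (fun h => by rw [h] at hdeg; simp at hdeg) (by omega)
  simp only [eval_mul, eval_X, eval_sub, eval_pow, eval_C, mul_ne_zero_iff] at hr
  obtain ⟨hr0, hr⟩ := hr
  refine ⟨(r + y / r) / 2, (r - y / r) / 2, ?_, ?_, by field_simp; ring⟩ <;>
  · intro h
    field_simp at h
    first
      | exact hr (by linear_combination (r ^ 2 - y) * h)
      | exact hr (by linear_combination (r ^ 2 + y) * h)

/-- In `𝔽_p` with `p ≥ 7`, every nonzero element is a sum of two nonzero squares. -/
theorem ZMod.exists_ne_zero_sq_add_sq {p : ℕ} [Fact p.Prime] (h7 : 7 ≤ p) {y : ZMod p}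
    (hy : y ≠ 0) : ∃ u v : ZMod p, u ≠ 0 ∧ v ≠ 0 ∧ y = u ^ 2 + v ^ 2 := by
  obtain ⟨-, h3, h4, h5⟩ := ZMod.prime_ge_seven_units h7
  -- If one of the two squares vanishes, the identity `3² + 4² = 5²` splits the other.
  have key (a : ZMod p) (ha : y = a ^ 2) : ∃ u v : ZMod p, u ≠ 0 ∧ v ≠ 0 ∧ y = u ^ 2 + v ^ 2 := by
    have ha0 : a ≠ 0 := by rintro rfl; simp [hy] at ha
    refine ⟨a * 3 / 5, a * 4 / 5, by simp [ha0, h3, h5], by simp [ha0, h4, h5], ?_⟩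
    rw [ha]; field_simp; ring
  obtain ⟨a, b, hab⟩ := ZMod.sq_add_sq p y
  rcases eq_or_ne a 0 with rfl | ha
  · exact key b (by rw [← hab]; ring)
  rcases eq_or_ne b 0 with rfl | hb
  · exact key a (by rw [← hab]; ring)
  exact ⟨a, b, ha, hb, hab.symm⟩

open Polynomial in
theorem ZMod.exists_ne_zero_sq_mul_ne {p : ℕ} [Fact p.Prime] (h7 : 7 ≤ p) {e : ZMod p}
    (he : e ≠ 0) (y : ZMod p) : ∃ w : ZMod p, w ≠ 0 ∧ y - e * w ^ 2 ≠ 0 := by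
  have hdeg : (X * (C y - C e * X ^ 2) : (ZMod p)[X]).natDegree = 3 := by
    compute_degree!
  obtain ⟨r, hr⟩ := ZMod.exists_ne_zero_eval_ne_zero
    (f := (X * (C y - C e * X ^ 2) : (ZMod p)[X]))
    (fun h => by rw [h] at hdeg; simp at hdeg) (by omega)
  simp only [eval_mul, eval_X, eval_sub, eval_pow, eval_C, mul_ne_zero_iff] at hr
  exact ⟨r, hr⟩

theorem ZMod.intUnits_cast_ne_zero {p : ℕ} [Fact p.Prime] (e : ℤˣ) : ((e : ℤ) : ZMod p) ≠ 0 := by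
  rcases Int.units_eq_one_or e with h | h <;> simp [h]

theorem ZMod.exists_signed_sq_add_sq {p : ℕ} [Fact p.Prime] (h7 : 7 ≤ p) (ε : Fin 2 → ℤˣ)
    {y : ZMod p} (hy : y ≠ 0 ∨ ∑ i, (ε i : ℤ) = 0 ∨ p % 4 = 1) :
    ∃ u : Fin 2 → ZMod p, (∀ i, u i ≠ 0) ∧ y = ∑ i, ((ε i : ℤ) : ZMod p) * u i ^ 2 := by
  suffices h : ∃ u v : ZMod p, u ≠ 0 ∧ v ≠ 0 ∧
      y = ((ε 0 : ℤ) : ZMod p) * u ^ 2 + ((ε 1 : ℤ) : ZMod p) * v ^ 2 by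
    obtain ⟨u, v, hu, hv, h⟩ := h
    exact ⟨![u, v], by simp [Fin.forall_fin_two, hu, hv], by simp [Fin.sum_univ_two, h]⟩
  -- Stated for `z` so as to serve both `y` (two plus signs) and `-y` (two minus signs).
  have hsame : ∑ i, (ε i : ℤ) ≠ 0 → ∀ z : ZMod p, (z = 0 ↔ y = 0) →
      ∃ u v : ZMod p, u ≠ 0 ∧ v ≠ 0 ∧ z = u ^ 2 + v ^ 2 := by
    intro hne z hz
    rcases eq_or_ne y 0 with h0 | h0
    · have h4 : p % 4 = 1 := by tauto
      obtain ⟨i, hi⟩ := (ZMod.exists_sq_eq_neg_one_iff (p := p)).mpr (by omega)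
      refine ⟨1, i, one_ne_zero, ?_, ?_⟩
      · rintro rfl; simp at hi
      · rw [hz.mpr h0, pow_two i, ← hi]; ring
    · exact ZMod.exists_ne_zero_sq_add_sq h7 (mt hz.mp h0)
  rw [Fin.sum_univ_two] at hsame
  obtain ⟨u, v, hu, hv, huv⟩ := ZMod.exists_sq_sub_sq h7 y
  rcases Int.units_eq_one_or (ε 0) with h0 | h0 <;>
    rcases Int.units_eq_one_or (ε 1) with h1 | h1 <;> rw [h0, h1] at hsame ⊢
  · obtain ⟨u, v, hu, hv, h⟩ := hsame (by norm_num) y Iff.rfl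
    exact ⟨u, v, hu, hv, by simpa using h⟩
  · exact ⟨u, v, hu, hv, by simp [huv, sub_eq_add_neg]⟩
  · exact ⟨v, u, hv, hu, by simp [huv]; ring⟩
  · obtain ⟨u, v, hu, hv, h⟩ := hsame (by norm_num) (-y) neg_eq_zero
    exact ⟨u, v, hu, hv, by simp; linear_combination -h⟩

/-- Spare terms are peeled off so that the remainder stays nonzero; two squares then suffice
whatever their signs. -/
theorem ZMod.exists_signed_sq_sum {p : ℕ} [Fact p.Prime] (h7 : 7 ≤ p) {k : ℕ}
    (ε : Fin (k + 2) → ℤˣ) {y : ZMod p} (hy : y ≠ 0 ∨ 0 < k) :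
    ∃ u : Fin (k + 2) → ZMod p, (∀ i, u i ≠ 0) ∧ y = ∑ i, ((ε i : ℤ) : ZMod p) * u i ^ 2 := by
  induction k generalizing y with
  | zero => exact ZMod.exists_signed_sq_add_sq h7 ε (Or.inl (by simpa using hy))
  | succ k ih =>
    obtain ⟨w, hw, hyw⟩ := ZMod.exists_ne_zero_sq_mul_ne h7 (ZMod.intUnits_cast_ne_zero (ε 0)) y
    obtain ⟨u, hu, h⟩ := ih (fun i => ε i.succ) (Or.inl hyw)
    refine ⟨Fin.cons w u, Fin.cases hw hu, ?_⟩
    rw [Fin.sum_univ_succ]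
    simp only [Fin.cons_zero, Fin.cons_succ]
    linear_combination h

/-- Over a prime `p ≥ 7`, three signed squares represent everything. -/
theorem isSignedSquareSum_prime {p k : ℕ} (hp : p.Prime) (h7 : 7 ≤ p) (hk : 3 ≤ k)
    (ε : Fin k → ℤˣ) (x : ℤ) : IsSignedSquareSum p ε x := by
  have : Fact p.Prime := ⟨hp⟩
  obtain ⟨k, rfl⟩ := Nat.exists_eq_add_of_le' (show 2 ≤ k by omega)
  exact isSignedSquareSum_iff_zmod.mpr (ZMod.exists_signed_sq_sum h7 ε (Or.inr (by omega)))

theorem isSignedSquareSum_two_prime {p : ℕ} (hp : p.Prime) (h7 : 7 ≤ p) (ε : Fin 2 → ℤˣ) (x : ℤ)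
    (h : ∑ i, (ε i : ℤ) = 0 ∨ p % 4 = 1) : IsSignedSquareSum p ε x := by
  have : Fact p.Prime := ⟨hp⟩
  exact isSignedSquareSum_iff_zmod.mpr (ZMod.exists_signed_sq_add_sq h7 ε (Or.inr h))

/-! ### Sums of signs and the prime 5 -/

theorem exists_signs_sum_eq {s k : ℕ} (h : s ≤ k) :
    ∃ ε : Fin k → ℤˣ, ∑ i, (ε i : ℤ) = 2 * s - k := by
  induction k generalizing s with
  | zero => obtain rfl : s = 0 := by omega
            exact ⟨fun _ => 1, by simp⟩
  | succ k ih =>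
    rcases Nat.eq_zero_or_pos s with rfl | hs
    · exact ⟨fun _ => -1, by simp⟩
    · obtain ⟨ε, hε⟩ := ih (s := s - 1) (by omega)
      refine ⟨Fin.cons 1 ε, ?_⟩
      rw [Fin.sum_univ_succ]
      simp only [Fin.cons_zero, Fin.cons_succ, hε]
      push_cast [Nat.cast_sub hs]
      ring

theorem exists_sum_signs_eq {k : ℕ} (ε : Fin k → ℤˣ) :
    ∃ s : ℕ, s ≤ k ∧ ∑ i, (ε i : ℤ) = 2 * s - k := by
  induction k with
  | zero => exact ⟨0, le_rfl, by simp⟩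
  | succ k ih =>
    obtain ⟨s, hs, h⟩ := ih fun i => ε i.succ
    rw [Fin.sum_univ_succ, h]
    rcases Int.units_eq_one_or (ε 0) with h0 | h0
    · exact ⟨s + 1, by omega, by rw [h0]; push_cast; ring⟩
    · exact ⟨s, by omega, by rw [h0]; push_cast; ring⟩

/-- Modulo `5`, four signed squares represent everything. -/
theorem isSignedSquareSum_five {k : ℕ} (hk : 4 ≤ k) (ε : Fin k → ℤˣ) (x : ℤ) :
    IsSignedSquareSum 5 ε x := by
  -- Since 3 inverts 2 modulo 5, this `s` gives `2s - k ≡ x`, and `s ≤ 4 ≤ k`. As `2² ≡ -1`, the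
  -- unit 2 flips a sign of `ε` into that of `η`.
  obtain ⟨η, hη⟩ := exists_signs_sum_eq (s := (3 * (x + k) % 5).toNat) (k := k) (by omega)
  refine ⟨fun i => if ε i = η i then 1 else 2, fun i => ?_, ?_⟩
  · dsimp only
    split_ifs
    · exact isCoprime_one_left
    · exact Int.isCoprime_iff_gcd_eq_one.mpr (by norm_num)
  · have h1 : (5 : ℤ) ∣ ∑ i, (η i : ℤ) -
        ∑ i, (ε i : ℤ) * (if ε i = η i then (1 : ℤ) else 2) ^ 2 := by
      rw [← Finset.sum_sub_distrib]
      refine Finset.dvd_sum fun i _ => ?_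
      rcases Int.units_eq_one_or (ε i) with h0 | h0 <;>
        rcases Int.units_eq_one_or (η i) with h1 | h1 <;> rw [h0, h1] <;> decide
    push_cast
    rw [hη] at h1
    omega

theorem not_isSignedSquareSum_five {k : ℕ} (hk : k ≤ 3) (hodd : Odd k) (ε : Fin k → ℤˣ) {x : ℤ}
    (hx : 5 ∣ x) : ¬ IsSignedSquareSum 5 ε x := by
  rintro ⟨u, hu, hux⟩
  have h (i) : ∃ η : ℤˣ, (5 : ℤ) ∣ (ε i : ℤ) * u i ^ 2 - (η : ℤ) := by
    have hu5 : ¬ (5 : ℤ) ∣ u i := fun h =>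
      by have := Int.isUnit_iff.mp ((hu i).isUnit_of_dvd' h (dvd_refl _)); norm_num at this
    have h5 : (5 : ℤ) ∣ u i ^ 2 - 1 ∨ (5 : ℤ) ∣ u i ^ 2 + 1 := by
      have hc : u i % 5 = 1 ∨ u i % 5 = 2 ∨ u i % 5 = 3 ∨ u i % 5 = 4 := by omega
      have hsq : u i ^ 2 % 5 = (u i % 5) ^ 2 % 5 := ((Int.mod_modEq (u i) 5).pow 2).symm
      rcases hc with h | h | h | h <;> rw [h] at hsq <;> omega
    rcases Int.units_eq_one_or (ε i) with h0 | h0 <;> rw [h0] <;> rcases h5 with h5 | h5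
    · exact ⟨1, by push_cast; omega⟩
    · exact ⟨-1, by push_cast; omega⟩
    · exact ⟨-1, by push_cast; omega⟩
    · exact ⟨1, by push_cast; omega⟩
  choose η hη using h
  have hs := Finset.dvd_sum fun i (_ : i ∈ Finset.univ) => hη i
  rw [Finset.sum_sub_distrib] at hs
  obtain ⟨s, hs', hη'⟩ := exists_sum_signs_eq η
  rw [hη'] at hs
  push_cast at hux
  obtain ⟨c, rfl⟩ := hodd
  -- The sign sum is odd and at most 3 in absolute value, hence not a multiple of 5.
  omega

/-! ### Obstructions modulo divisors of 24 and modulo primes -/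

theorem sq_mod_eq_of_dvd_twentyFour {d : ℕ} (hd : d ∣ 24) {u : ℤ} (hu : IsCoprime u (d : ℤ)) :
    (d : ℤ) ∣ u ^ 2 - 1 := by
  have key : ∀ d ∈ Nat.divisors 24, ∀ r < d, Nat.Coprime r d → (d : ℤ) ∣ (r : ℤ) ^ 2 - 1 := by
    decide
  have hd0 : 0 < d := Nat.pos_of_dvd_of_pos hd (by norm_num)
  obtain ⟨r, hr⟩ := Int.eq_ofNat_of_zero_le (Int.emod_nonneg u (b := (d : ℤ)) (by omega))
  have hrd : (d : ℤ) ∣ (r : ℤ) - u := by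
    rw [← hr]; exact ⟨-(u / d), by linear_combination Int.emod_add_mul_ediv u d⟩
  have h := key d (by simp [hd]) r
    (by have := Int.emod_lt_of_pos u (b := (d : ℤ)) (by omega); omega)
    (Nat.isCoprime_iff_coprime.mp (Int.isCoprime_of_dvd_sub hrd hu))
  obtain ⟨a, ha⟩ := h
  obtain ⟨b, hb⟩ := hrd
  exact ⟨a - b * (r + u), by linear_combination ha - (r + u) * hb⟩

theorem IsSignedSquareSum.dvd_sub_sum {n d k : ℕ} {ε : Fin k → ℤˣ} {x : ℤ}
    (h : IsSignedSquareSum n ε x) (hdn : d ∣ n) (hd : d ∣ 24) :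
    (d : ℤ) ∣ x - ∑ i, (ε i : ℤ) := by
  obtain ⟨u, hu, hx⟩ := h.of_dvd hdn
  have h1 : (d : ℤ) ∣ ∑ i, (ε i : ℤ) * u i ^ 2 - ∑ i, (ε i : ℤ) := by
    rw [← Finset.sum_sub_distrib]
    refine Finset.dvd_sum fun i _ => ?_
    obtain ⟨c, hc⟩ := sq_mod_eq_of_dvd_twentyFour hd (hu i)
    exact ⟨ε i * c, by linear_combination (ε i : ℤ) * hc⟩
  simpa using dvd_add hx h1

theorem not_isSignedSquareSum_one {p : ℕ} (hp : p.Prime) (ε : Fin 1 → ℤˣ) {x : ℤ}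
    (hx : (p : ℤ) ∣ x) : ¬ IsSignedSquareSum p ε x := by
  have : Fact p.Prime := ⟨hp⟩
  rw [isSignedSquareSum_iff_zmod, (ZMod.intCast_zmod_eq_zero_iff_dvd x p).mpr hx]
  rintro ⟨u, hu, h⟩
  have := ZMod.intUnits_cast_ne_zero (p := p) (ε 0)
  simp [this, hu] at h

/-- Equal signs would make -1 a square modulo `p`. -/
theorem IsSignedSquareSum.sum_eq_zero_of_prime {p : ℕ} (hp : p.Prime) (h4 : p % 4 = 3)
    {ε : Fin 2 → ℤˣ} {x : ℤ} (hx : (p : ℤ) ∣ x) (h : IsSignedSquareSum p ε x) :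
    ∑ i, (ε i : ℤ) = 0 := by
  have : Fact p.Prime := ⟨hp⟩
  rw [isSignedSquareSum_iff_zmod, (ZMod.intCast_zmod_eq_zero_iff_dvd x p).mpr hx] at h
  obtain ⟨u, hu, h⟩ := h
  rw [Fin.sum_univ_two] at h ⊢
  have h3 : (u 0) ^ 2 ≠ -(u 1) ^ 2 := fun h =>
    ZMod.mod_four_ne_three_of_sq_eq_neg_sq' (hu 1) h h4
  rcases Int.units_eq_one_or (ε 0) with h0 | h0 <;>
    rcases Int.units_eq_one_or (ε 1) with h1 | h1 <;> rw [h0, h1] at h ⊢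
  · exact absurd (by simp at h; linear_combination -h) h3
  · norm_num
  · norm_num
  · exact absurd (by simp at h; linear_combination h) h3

/-! ### From signed sums to distances in the graph -/

theorem mem_signedQuadraticUnits_iff {n : ℕ} {t : ZMod n} : t ∈ signedQuadraticUnits n ↔
    ∃ (e : ℤˣ) (w : ℤ), IsCoprime w (n : ℤ) ∧ t = ((e : ℤ) * w ^ 2 : ℤ) := by
  have key (q : ZMod n) : q ∈ quadraticUnits n ↔
      ∃ w : ℤ, IsCoprime w (n : ℤ) ∧ q = (w ^ 2 : ℤ) := by
    constructor
    · rintro ⟨u, rfl⟩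
      obtain ⟨w, hw⟩ := ZMod.intCast_surjective (u : ZMod n)
      refine ⟨w, ?_, by push_cast; rw [hw]⟩
      rw [isCoprime_comm, ← ZMod.coe_int_isUnit_iff_isCoprime, hw]
      exact u.isUnit
    · rintro ⟨w, hw, rfl⟩
      rw [isCoprime_comm, ← ZMod.coe_int_isUnit_iff_isCoprime] at hw
      obtain ⟨u, hu⟩ := hw
      exact ⟨u, by push_cast; rw [hu]⟩
  rw [signedQuadraticUnits, Set.mem_ofPred_eq, key, key]
  constructor
  · rintro (⟨w, hw, h⟩ | ⟨w, hw, h⟩)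
    · exact ⟨1, w, hw, by simpa using h⟩
    · exact ⟨-1, w, hw, by rw [← neg_neg t, h]; simp⟩
  · rintro ⟨e, w, hw, rfl⟩
    rcases Int.units_eq_one_or e with rfl | rfl
    · exact Or.inl ⟨w, hw, by simp⟩
    · exact Or.inr ⟨w, hw, by simp⟩

theorem IsSignedSquareSum.edist_le {n k : ℕ} {ε : Fin k → ℤˣ} {x : ℤ}
    (h : IsSignedSquareSum n ε x) (a : ZMod n) :
    (quadraticUnitaryCayleyGraph n).edist a (a + x) ≤ k := by
  induction k generalizing x a with
  | zero =>
    obtain ⟨u, -, hx⟩ := h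
    simp only [Finset.univ_eq_empty, Finset.sum_empty, sub_zero] at hx
    simp [(CharP.intCast_eq_zero_iff (ZMod n) n x).mpr hx]
  | succ k ih =>
    rw [← Fin.cons_self_tail ε, isSignedSquareSum_cons] at h
    obtain ⟨w, hw, h⟩ := h
    set b : ZMod n := a + ((ε 0 : ℤ) * w ^ 2 : ℤ) with hb
    have hab : (quadraticUnitaryCayleyGraph n).edist a b ≤ 1 := by
      rw [SimpleGraph.edist_le_one_iff_adj_or_eq]
      -- Equality occurs only for `n = 1`, where the loop is dropped.
      by_cases hne : a = b
      · exact Or.inr hne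
      · refine Or.inl (SimpleGraph.Adj.symm ?_)
        rw [quadraticUnitaryCayleyGraph_adj]
        exact ⟨Ne.symm hne, mem_signedQuadraticUnits_iff.mpr ⟨ε 0, w, hw, by rw [hb]; ring⟩⟩
    have hbx : b + ((x - (ε 0 : ℤ) * w ^ 2 : ℤ) : ZMod n) = a + x := by
      rw [hb]; push_cast; ring
    calc _ ≤ _ := SimpleGraph.edist_triangle (v := b)
      _ ≤ 1 + (k : ℕ∞) := add_le_add hab (hbx ▸ ih h b)
      _ = _ := by push_cast; rw [add_comm]

theorem exists_isSignedSquareSum_of_walk {n : ℕ} {a b : ZMod n}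
    (p : (quadraticUnitaryCayleyGraph n).Walk a b) {x : ℤ} (hx : (x : ZMod n) = a - b) :
    ∃ ε : Fin p.length → ℤˣ, IsSignedSquareSum n ε x := by
  induction p generalizing x with
  | nil =>
    rw [sub_self, CharP.intCast_eq_zero_iff (ZMod n) n] at hx
    exact ⟨_, isSignedSquareSum_of_dvd_sub_sum (k := 0) (ε := fun _ => 1) (by simpa using hx)⟩
  | @cons a c b h p ih =>
    rw [quadraticUnitaryCayleyGraph_adj] at h
    obtain ⟨e, w, hw, hac⟩ := mem_signedQuadraticUnits_iff.mp h.2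
    obtain ⟨ε, hε⟩ := ih (x := x - (e : ℤ) * w ^ 2) (by
      rw [Int.cast_sub, ← hac, hx]; ring)
    exact ⟨Fin.cons e ε, (isSignedSquareSum_cons e ε x).mpr ⟨w, hw, hε⟩⟩

theorem ediam_quadraticUnitaryCayleyGraph_le {n k : ℕ}
    (h : ∀ x : ℤ, ∃ j ≤ k, ∃ ε : Fin j → ℤˣ, IsSignedSquareSum n ε x) :
    (quadraticUnitaryCayleyGraph n).ediam ≤ k := by
  refine SimpleGraph.ediam_le_of_edist_le fun a b => ?_
  obtain ⟨x, hx⟩ := ZMod.intCast_surjective (b - a)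
  obtain ⟨j, hj, ε, hε⟩ := h x
  have := hε.edist_le a
  rw [hx, add_sub_cancel] at this
  exact this.trans (by exact_mod_cast hj)

theorem le_ediam_quadraticUnitaryCayleyGraph {n k : ℕ} (x : ℤ)
    (h : ∀ j < k, ∀ ε : Fin j → ℤˣ, ¬ IsSignedSquareSum n ε x) :
    (k : ℕ∞) ≤ (quadraticUnitaryCayleyGraph n).ediam := by
  refine le_trans ?_ (SimpleGraph.edist_le_ediam (u := (x : ZMod n)) (v := 0))
  by_contra! hlt
  obtain ⟨p, hp⟩ := SimpleGraph.exists_walk_of_edist_ne_top (ne_top_of_lt hlt)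
  rw [← hp] at hlt
  obtain ⟨ε, hε⟩ := exists_isSignedSquareSum_of_walk p (x := x) (by simp)
  exact h _ (by exact_mod_cast hlt) ε hε

/-! ### Upper bounds -/

theorem exists_isSignedSquareSum {n d k : ℕ} (hn : 0 < n) (hd0 : 0 < d)
    (hd : n.gcd 24 ∣ 2 * d) (hdk : d ≤ k + 1) (h3 : 3 ≤ k) (h5 : 5 ∣ n → 4 ≤ k) {x : ℤ}
    (hx : (2 : ℤ) ∣ x + k) : ∃ ε : Fin k → ℤˣ, IsSignedSquareSum n ε x := by
  obtain ⟨m, hm⟩ := hx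
  have hm0 := Int.emod_nonneg m (b := (d : ℤ)) (by omega)
  have hm1 := Int.emod_lt_of_pos m (b := (d : ℤ)) (by omega)
  obtain ⟨s, hs⟩ := Int.eq_ofNat_of_zero_le hm0
  -- With `x + k = 2m` and `s = m mod d`, the sum `2s - k` is congruent to `x` modulo `2d`, and `s ≤
  -- d - 1 ≤ k`.
  obtain ⟨ε, hε⟩ := exists_signs_sum_eq (s := s) (k := k) (by omega)
  refine ⟨ε, isSignedSquareSum_of_local hn (by omega) ?_ fun p hp hp5 hpn => ?_⟩
  · refine dvd_trans (b := ((2 * d : ℕ) : ℤ)) (by exact_mod_cast hd) ⟨m / d, ?_⟩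
    rw [hε]
    push_cast
    linear_combination hm + 2 * hs - 2 * Int.emod_add_mul_ediv m d
  · rcases eq_or_ne p 5 with rfl | hp5'
    · exact isSignedSquareSum_five (h5 hpn) ε x
    · have : p ≠ 6 := by rintro rfl; revert hp; decide
      exact isSignedSquareSum_prime hp (by omega) h3 ε x

theorem isSignedSquareSum_two {n : ℕ} (hn : 0 < n) (h5 : ¬ 5 ∣ n) {ε : Fin 2 → ℤˣ} {x : ℤ}
    (h24 : (n.gcd 24 : ℤ) ∣ x - ∑ i, (ε i : ℤ))
    (h : ∑ i, (ε i : ℤ) = 0 ∨ ∀ p : ℕ, p.Prime → p ∣ n → 5 ≤ p → p % 4 = 1) :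
    IsSignedSquareSum n ε x := by
  refine isSignedSquareSum_of_local hn (by omega) h24 fun p hp hp5 hpn => ?_
  have : p ≠ 5 := by rintro rfl; exact h5 hpn
  have : p ≠ 6 := by rintro rfl; revert hp; decide
  exact isSignedSquareSum_two_prime hp (by omega) ε x (h.imp_right fun h => h p hp hpn hp5)

/-- Every `x` is a sum of at most `k` signed squares, if `k` is large against `gcd(n, 24)`. -/
theorem ediam_le_of_gcd_dvd {n d k : ℕ} (hn : 0 < n) (hd0 : 0 < d) (hd : n.gcd 24 ∣ 2 * d)
    (hdk : d ≤ k) (h4 : 4 ≤ k) (h5 : 5 ∣ n → 5 ≤ k) :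
    (quadraticUnitaryCayleyGraph n).ediam ≤ k := by
  refine ediam_quadraticUnitaryCayleyGraph_le fun x => ?_
  -- Whichever of `k` and `k - 1` has the parity of `x` is used, hence bounds stronger by one than
  -- in `exists_isSignedSquareSum`.
  rcases Int.even_or_odd' (x + k) with ⟨c, hc | hc⟩
  · exact ⟨k, le_rfl, exists_isSignedSquareSum hn hd0 hd (by omega) (by omega) (by omega) ⟨c, hc⟩⟩
  · exact ⟨k - 1, by omega, exists_isSignedSquareSum hn hd0 hd (by omega) (by omega) (by omega)
      ⟨c, by omega⟩⟩

theorem ediam_le_four_of_odd {n : ℕ} (hn : Odd n) :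
    (quadraticUnitaryCayleyGraph n).ediam ≤ 4 := by
  refine ediam_quadraticUnitaryCayleyGraph_le (k := 4) fun x => ⟨4, le_rfl, ?_⟩
  -- For odd `n` parity is no constraint: `(n + 1) * x` is an even representative of `x`, so four
  -- terms always work.
  obtain ⟨ε, hε⟩ : ∃ ε : Fin 4 → ℤˣ, IsSignedSquareSum n ε (x + n * x) := by
    obtain ⟨c, hc⟩ := hn
    refine exists_isSignedSquareSum (d := 3) (by omega) (by omega) ?_ (by omega) (by omega)
      (fun _ => le_rfl) ⟨(c + 1) * x + 2, by rw [hc]; push_cast; ring⟩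
    have h1 := Nat.gcd_dvd_left n 24
    have h2 := Nat.gcd_dvd_right n 24
    have h3 := Nat.le_of_dvd (by omega) h2
    generalize n.gcd 24 = g at *
    interval_cases g <;> omega
  exact ⟨ε, hε.congr ⟨-x, by ring⟩⟩

theorem gcd_twentyFour_dvd {n d : ℕ} (hd : d ∣ 24) (h16 : 2 * d ∣ 24 → ¬ 2 * d ∣ n)
    (h3 : 3 * d ∣ 24 → ¬ 3 * d ∣ n) (hdn : d ∣ n) : n.gcd 24 ∣ d := by
  obtain ⟨c, hc⟩ := Nat.dvd_gcd hdn hd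
  have hgn := Nat.gcd_dvd_left n 24
  have hg := Nat.gcd_dvd_right n 24
  rw [hc] at hg hgn ⊢
  have h2c : ¬ 2 ∣ c := fun ⟨e, he⟩ => by
    have h : 2 * d ∣ d * c := ⟨e, by rw [he]; ring⟩
    exact h16 (h.trans hg) (h.trans hgn)
  have h3c : ¬ 3 ∣ c := fun ⟨e, he⟩ => by
    have h : 3 * d ∣ d * c := ⟨e, by rw [he]; ring⟩
    exact h3 (h.trans hg) (h.trans hgn)
  have hc24 : c ∣ 24 := (dvd_mul_left c d).trans hg
  have := Nat.le_of_dvd (by norm_num) hc24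
  have : c = 1 := by interval_cases c <;> omega
  simp [this]

theorem gcd_twentyFour_dvd_eight {n : ℕ} (h3 : ¬ 3 ∣ n) : n.gcd 24 ∣ 2 * 4 := by
  have hcop : (n.gcd 24).Coprime 3 := by
    rw [Nat.coprime_comm, Nat.Prime.coprime_iff_not_dvd Nat.prime_three]
    exact fun h => h3 (h.trans (Nat.gcd_dvd_left _ _))
  exact hcop.dvd_of_dvd_mul_left (show n.gcd 24 ∣ 3 * (2 * 4) from Nat.gcd_dvd_right n 24)

/-! ### Lower bounds -/

/-- A lower bound for the diameter from a common divisor of `n` and `24`. -/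
theorem le_ediam_of_dvd {n k : ℕ} (hk : 2 * k ∣ 24) (hkn : 2 * k ∣ n) :
    (k : ℕ∞) ≤ (quadraticUnitaryCayleyGraph n).ediam := by
  refine le_ediam_quadraticUnitaryCayleyGraph (k : ℤ) fun j hj ε hε => ?_
  obtain ⟨c, hc⟩ := hε.dvd_sub_sum hkn hk
  obtain ⟨s, hs, hsum⟩ := exists_sum_signs_eq ε
  rw [hsum] at hc
  push_cast at hc
  -- A sum of `j < k` signs lies strictly between `-k` and `k`, so its difference from `k` lies
  -- strictly between 0 and `2k`.
  have h1 : 0 < c := by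
    by_contra! h
    nlinarith
  nlinarith

theorem five_le_ediam {n : ℕ} (h10 : 10 ∣ n) :
    (5 : ℕ∞) ≤ (quadraticUnitaryCayleyGraph n).ediam := by
  refine le_ediam_quadraticUnitaryCayleyGraph (k := 5) 5 fun j hj ε hε => ?_
  have h2 := hε.dvd_sub_sum (d := 2) (by omega) (by norm_num)
  obtain ⟨s, hs, hsum⟩ := exists_sum_signs_eq ε
  have hodd : Odd j := by
    rw [Nat.odd_iff]
    push_cast at h2
    omega
  have hj4 : j ≠ 4 := by rintro rfl; revert hodd; decide
  exact not_isSignedSquareSum_five (by omega) hodd ε (dvd_refl _) (hε.of_dvd (by omega))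

theorem three_le_ediam {n p : ℕ} (hp : p.Prime) (hp2 : p ≠ 2) (h2 : 2 ∣ n) (hpn : p ∣ n) :
    (3 : ℕ∞) ≤ (quadraticUnitaryCayleyGraph n).ediam := by
  refine le_ediam_quadraticUnitaryCayleyGraph (k := 3) p fun j hj ε hε => ?_
  have h2 := hε.dvd_sub_sum (d := 2) h2 (by norm_num)
  obtain ⟨s, hs, hsum⟩ := exists_sum_signs_eq ε
  have hodd := Nat.odd_iff.mp (hp.odd_of_ne_two hp2)
  have hj1 : j = 1 := by
    push_cast at h2
    omega
  subst hj1
  exact not_isSignedSquareSum_one hp ε (dvd_refl _) (hε.of_dvd hpn)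

/-- The target `2p` is even and not divisible by `d`, so fewer than four terms means exactly two.
The prime `p` forces opposite signs, and then `d` would divide `2p`. -/
theorem four_le_ediam {n p d : ℕ} (hp : p.Prime) (h3 : 3 < p) (h4 : p % 4 = 3) (hpn : p ∣ n)
    (hd : d = 4 ∨ d = 6) (hdn : d ∣ n) :
    (4 : ℕ∞) ≤ (quadraticUnitaryCayleyGraph n).ediam := by
  refine le_ediam_quadraticUnitaryCayleyGraph (k := 4) (2 * p) fun j hj ε hε => ?_
  have hd2 := hε.dvd_sub_sum hdn (by rcases hd with rfl | rfl <;> norm_num)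
  obtain ⟨s, hs, hsum⟩ := exists_sum_signs_eq ε
  have hp3 : ¬ 3 ∣ p := fun h => by
    have := (Nat.prime_dvd_prime_iff_eq Nat.prime_three hp).mp h
    omega
  have hj2 : j = 2 := by rcases hd with rfl | rfl <;> push_cast at hd2 <;> omega
  subst hj2
  have h0 := (hε.of_dvd hpn).sum_eq_zero_of_prime hp h4 (dvd_mul_left _ _)
  rw [h0] at hd2
  rcases hd with rfl | rfl <;> push_cast at hd2 <;> omega

/-! ### Diameters three and four, small moduli and the classification -/

theorem ediam_le_three_add_deltaThree {n d : ℕ} (hn : 0 < n) (h5 : ¬ 5 ∣ n) (hd0 : 0 < d)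
    (hd : n.gcd 24 ∣ 2 * d) (hd3 : d ≤ 3) :
    (quadraticUnitaryCayleyGraph n).ediam ≤ ((3 + deltaThree n : ℕ) : ℕ∞) := by
  unfold deltaThree
  split_ifs with hδ
  · exact ediam_le_of_gcd_dvd hn hd0 hd (by omega) (by omega) (fun h => absurd h h5)
  · refine ediam_quadraticUnitaryCayleyGraph_le fun x => ?_
    -- Two terms reach every even `x`, since `s = (c + 1) mod d ≤ 2`, and without a prime `p ≡ 3
    -- (mod 4)` above 3 the signs are free. Odd `x` take three.
    rcases Int.even_or_odd' x with ⟨c, hc | hc⟩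
    · have hm0 := Int.emod_nonneg (c + 1) (b := (d : ℤ)) (by omega)
      have hm1 := Int.emod_lt_of_pos (c + 1) (b := (d : ℤ)) (by omega)
      obtain ⟨s, hs⟩ := Int.eq_ofNat_of_zero_le hm0
      obtain ⟨ε, hε⟩ := exists_signs_sum_eq (s := s) (k := 2) (by omega)
      refine ⟨2, by omega, ε, isSignedSquareSum_two hn h5 ?_ (Or.inr fun p hp hpn hp5 => ?_)⟩
      · refine dvd_trans (b := ((2 * d : ℕ) : ℤ)) (by exact_mod_cast hd) ⟨(c + 1) / d, ?_⟩
        rw [hε]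
        push_cast
        linear_combination hc + 2 * hs - 2 * Int.emod_add_mul_ediv (c + 1) d
      · by_contra h1
        refine hδ ⟨p, by simp [hp, hpn, hn.ne'], by omega, ?_⟩
        have := Nat.odd_iff.mp (hp.odd_of_ne_two (by omega))
        omega
    · exact ⟨3, by omega, exists_isSignedSquareSum hn hd0 hd (by omega) le_rfl
        (fun h => absurd h h5) ⟨c + 2, by push_cast; omega⟩⟩

theorem ediam_eq_three_add_deltaThree {n d : ℕ} (hn : 0 < n) (h5 : ¬ 5 ∣ n)
    (hd : d = 2 ∨ d = 3) (hdn : 2 * d ∣ n) (hgcd : n.gcd 24 ∣ 2 * d)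
    (h3 : (3 : ℕ∞) ≤ (quadraticUnitaryCayleyGraph n).ediam) :
    (quadraticUnitaryCayleyGraph n).ediam = ((3 + deltaThree n : ℕ) : ℕ∞) := by
  refine le_antisymm (ediam_le_three_add_deltaThree hn h5 (by omega) hgcd (by omega)) ?_
  unfold deltaThree
  split_ifs with hδ
  · obtain ⟨p, hp, hp3, hp4⟩ := hδ
    rw [Nat.mem_primeFactors] at hp
    exact four_le_ediam hp.1 hp3 hp4 hp.2.1 (by omega) hdn
  · exact h3

theorem ediam_eq_three {n p : ℕ} (hn : 0 < n) (h5 : ¬ 5 ∣ n) (hgcd : n.gcd 24 ∣ 2)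
    (h2 : 2 ∣ n) (hp : p.Prime) (hp2 : p ≠ 2) (hpn : p ∣ n) :
    (quadraticUnitaryCayleyGraph n).ediam = 3 := by
  refine le_antisymm (ediam_quadraticUnitaryCayleyGraph_le (k := 3) fun x => ?_)
    (three_le_ediam hp hp2 h2 hpn)
  rcases Int.even_or_odd' x with ⟨c, hc | hc⟩
  · have h0 : ∑ i, ((![1, -1] : Fin 2 → ℤˣ) i : ℤ) = 0 := by simp
    refine ⟨2, by omega, ![1, -1], isSignedSquareSum_two hn h5 ?_ (Or.inl h0)⟩
    rw [h0]
    exact dvd_trans (b := ((2 : ℕ) : ℤ)) (by exact_mod_cast hgcd) ⟨c, by push_cast; omega⟩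
  · exact ⟨3, le_rfl, exists_isSignedSquareSum hn one_pos hgcd (by omega) le_rfl
      (fun h => absurd h h5) ⟨c + 2, by push_cast; omega⟩⟩

theorem ediam_le_of_le {n k : ℕ} (hn : 0 < n) (hnk : n ≤ 2 * k) :
    (quadraticUnitaryCayleyGraph n).ediam ≤ k := by
  refine ediam_quadraticUnitaryCayleyGraph_le fun x => ?_
  have hm0 := Int.emod_nonneg x (b := (n : ℤ)) (by omega)
  have hm1 := Int.emod_lt_of_pos x (b := (n : ℤ)) (by omega)
  obtain ⟨r, hr⟩ := Int.eq_ofNat_of_zero_le hm0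
  have hdiv := Int.emod_add_mul_ediv x n
  rcases le_or_gt r k with h | h
  · exact ⟨r, h, fun _ => 1, isSignedSquareSum_of_dvd_sub_sum ⟨x / n, by simp; linarith⟩⟩
  · refine ⟨n - r, by omega, fun _ => -1, isSignedSquareSum_of_dvd_sub_sum ⟨x / n + 1, ?_⟩⟩
    simp [Nat.cast_sub (show r ≤ n by omega)]
    linarith

theorem exists_odd_prime_dvd {K : ℕ} (hK : 1 < K) (h30 : K.Coprime 30) :
    ∃ p : ℕ, p.Prime ∧ p ≠ 2 ∧ p ∣ K := by
  refine ⟨K.minFac, Nat.minFac_prime hK.ne', fun h => ?_, Nat.minFac_dvd K⟩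
  have h2 : 2 ∣ K := h ▸ Nat.minFac_dvd K
  exact absurd (Nat.dvd_gcd h2 (show 2 ∣ 30 by norm_num)) (by rw [h30]; norm_num)

theorem Nat.Coprime.not_dvd_of_prime_dvd {K m p : ℕ} (h : K.Coprime m) (hp : p.Prime)
    (hpm : p ∣ m) : ¬ p ∣ K := fun hpK => hp.one_lt.ne' (Nat.eq_one_of_dvd_coprimes h hpK hpm)

/-- `SimpleGraph.ediam` is the supremum in `ℕ∞` of the distances, infinite for a disconnected
graph, so that each assertion below includes the connectedness of the graph. -/
theorem mainTheorem1 :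
    (∀ n : ℕ, 0 < n → Even n →
      ((24 ∣ n → (quadraticUnitaryCayleyGraph n).ediam = 12) ∧
      ((∃ k : ℕ, Odd k ∧ n = 12 * k) → (quadraticUnitaryCayleyGraph n).ediam = 6) ∧
      (10 ∣ n → ¬ 12 ∣ n → (quadraticUnitaryCayleyGraph n).ediam = 5) ∧
      (∀ K : ℕ, 0 < K → K.Coprime 15 → n = 8 * K →
        (quadraticUnitaryCayleyGraph n).ediam = 4) ∧
      (∀ K : ℕ, 0 < K → K.Coprime 10 → n = 6 * K →
        (quadraticUnitaryCayleyGraph n).ediam = ((3 + deltaThree n : ℕ) : ℕ∞)) ∧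
      (∀ K : ℕ, 1 < K → K.Coprime 30 → n = 4 * K →
        (quadraticUnitaryCayleyGraph n).ediam = ((3 + deltaThree n : ℕ) : ℕ∞)) ∧
      (∀ K : ℕ, 1 < K → K.Coprime 30 → n = 2 * K →
        (quadraticUnitaryCayleyGraph n).ediam = 3) ∧
      (n = 4 → (quadraticUnitaryCayleyGraph n).ediam = 2) ∧
      (n = 2 → (quadraticUnitaryCayleyGraph n).ediam = 1))) ∧
    (∀ n : ℕ, 0 < n → (quadraticUnitaryCayleyGraph n).ediam ≤ 12) ∧
    (∀ p m : ℕ, p.Prime → (quadraticUnitaryCayleyGraph (p ^ m)).ediam ≤ 4) := by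
  refine ⟨fun n hn heven => ?_, fun n hn => ?_, fun p m hp => ?_⟩
  · have h2n : 2 ∣ n := heven.two_dvd
    refine ⟨fun h => ?_, ?_, fun h10 h12 => ?_, fun K hK hcop h => ?_, fun K hK hcop h => ?_,
      fun K hK hcop h => ?_, fun K hK hcop h => ?_, fun h => ?_, fun h => ?_⟩
    · exact le_antisymm (ediam_le_of_gcd_dvd (d := 12) (k := 12) hn (by norm_num)
        (Nat.gcd_dvd_right _ _) (by norm_num) (by norm_num) (by norm_num))
        (le_ediam_of_dvd (k := 12) (by norm_num) h)
    · rintro ⟨k, hk, h⟩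
      obtain ⟨c, hc⟩ := hk
      exact le_antisymm (ediam_le_of_gcd_dvd (d := 6) (k := 6) hn (by norm_num)
        (gcd_twentyFour_dvd (by norm_num) (by omega) (by omega) (by omega))
        (by norm_num) (by norm_num) (by norm_num))
        (le_ediam_of_dvd (k := 6) (by norm_num) (by omega))
    · refine le_antisymm ?_ (five_le_ediam h10)
      by_cases h3 : 3 ∣ n
      · exact ediam_le_of_gcd_dvd (d := 3) (k := 5) hn (by norm_num)
          (gcd_twentyFour_dvd (by norm_num) (by omega) (by omega) (by omega))
          (by norm_num) (by norm_num) (by norm_num)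
      · exact ediam_le_of_gcd_dvd (d := 4) (k := 5) hn (by norm_num)
          (gcd_twentyFour_dvd_eight h3) (by norm_num) (by norm_num) (by norm_num)
    · have h3 := hcop.not_dvd_of_prime_dvd Nat.prime_three (by norm_num)
      have h5 := hcop.not_dvd_of_prime_dvd Nat.prime_five (by norm_num)
      exact le_antisymm (ediam_le_of_gcd_dvd (d := 4) (k := 4) hn (by norm_num)
        (gcd_twentyFour_dvd_eight (by omega)) (by norm_num) (by norm_num) (by omega))
        (le_ediam_of_dvd (k := 4) (by norm_num) (by omega))
    · have h2 := hcop.not_dvd_of_prime_dvd Nat.prime_two (by norm_num)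
      have h5 := hcop.not_dvd_of_prime_dvd Nat.prime_five (by norm_num)
      exact ediam_eq_three_add_deltaThree (d := 3) hn (by omega) (by omega) (by omega)
        (gcd_twentyFour_dvd (by norm_num) (by omega) (by omega) (by omega))
        (le_ediam_of_dvd (k := 3) (by norm_num) (by omega))
    · have h2 := hcop.not_dvd_of_prime_dvd Nat.prime_two (by norm_num)
      have h3 := hcop.not_dvd_of_prime_dvd Nat.prime_three (by norm_num)
      have h5 := hcop.not_dvd_of_prime_dvd Nat.prime_five (by norm_num)
      obtain ⟨p, hp, hp2, hpK⟩ := exists_odd_prime_dvd hK hcop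
      exact ediam_eq_three_add_deltaThree (d := 2) hn (by omega) (by omega) (by omega)
        (gcd_twentyFour_dvd (by norm_num) (by omega) (by omega) (by omega))
        (three_le_ediam hp hp2 h2n (h ▸ hpK.mul_left 4))
    · have h2 := hcop.not_dvd_of_prime_dvd Nat.prime_two (by norm_num)
      have h3 := hcop.not_dvd_of_prime_dvd Nat.prime_three (by norm_num)
      have h5 := hcop.not_dvd_of_prime_dvd Nat.prime_five (by norm_num)
      obtain ⟨p, hp, hp2, hpK⟩ := exists_odd_prime_dvd hK hcop
      exact ediam_eq_three hn (by omega)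
        (gcd_twentyFour_dvd (by norm_num) (by omega) (by omega) h2n) h2n hp hp2
        (h ▸ hpK.mul_left 2)
    · exact le_antisymm (ediam_le_of_le (k := 2) hn (by omega))
        (le_ediam_of_dvd (k := 2) (by norm_num) (by omega))
    · exact le_antisymm (ediam_le_of_le (k := 1) hn (by omega))
        (le_ediam_of_dvd (k := 1) (by norm_num) (by omega))
  · exact ediam_le_of_gcd_dvd (d := 12) (k := 12) hn (by norm_num)
      (Nat.gcd_dvd_right _ _) (by norm_num) (by norm_num) (by norm_num)
  · rcases hp.eq_two_or_odd' with rfl | hodd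
    · have h (q : ℕ) (hq : q.Prime) (hq2 : q ≠ 2) : ¬ q ∣ 2 ^ m := fun h =>
        hq2 ((Nat.prime_dvd_prime_iff_eq hq Nat.prime_two).mp (hq.dvd_of_dvd_pow h))
      exact ediam_le_of_gcd_dvd (d := 4) (k := 4) (by positivity) (by norm_num)
        (gcd_twentyFour_dvd_eight (h 3 Nat.prime_three (by norm_num))) (by norm_num) (by norm_num)
        fun h5 => absurd h5 (h 5 Nat.prime_five (by norm_num))
    · exact ediam_le_four_of_odd hodd.pow
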